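/- Work over $\mathbb{C}$. For $n\ge 0$ let $V(n)$ be the simple $\mathfrak{sl}_2$-module of dimension $n+1$, with basis $v_0,\dots,v_n$ and action $h v_p=(n-2p)v_p$, $e v_p=(n-p+1)v_{p-1}$, $f v_p=(p+1)v_{p+1}$ (where $v_{-1}=v_{n+1}=0$). Put $V(1)^{\otimes 0}=V(0)$ and $V(1)^{\otimes (N+1)}=V(1)^{\otimes N}\otimes V(1)$. For integers $k,N\ge 0$ let $t(k,N)$ be the multiplicity of $V(k)$ in $V(1)^{\otimes N}$; that is, $t$ is the unique family of non-negative integers such that, for every $N\ge 0$, $$V(1)^{\otimes N}\;\cong\;\bigoplus_{k\ge 0}V(k)^{\oplus t(k,N)}$$ as $\mathfrak{sl}_2$-modules. This family exists and is unique, and for all integers $k\ge 1$, $N\ge 1$ and $1\le k'\le k$, $$t(k,N)=\sum_{i=0}^{N-1}t(k'-1,i)\,t(k-k',N-i-1).$$ -/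

import Mathlib

open scoped TensorProduct DirectSum

namespace SlTwo

/-- The complex Lie algebra `sl₂` of traceless `2 × 2` matrices. -/
abbrev L : Type := LieAlgebra.SpecialLinear.sl (Fin 2) ℂ

/-- The vector space `V(n) = ℂ ^ (n + 1)`, with standard basis `v₀, …, vₙ`; its elements are given
by their coordinates. -/
@[ext]
structure V (n : ℕ) where
  coord : Fin (n + 1) → ℂ

/-- The coordinates on `V(n)`, as a bijection. -/
def V.equiv (n : ℕ) : V n ≃ (Fin (n + 1) → ℂ) where
  toFun := V.coord
  invFun := V.mk
  left_inv _ := rfl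
  right_inv _ := rfl

noncomputable instance (n : ℕ) : AddCommGroup (V n) := (V.equiv n).addCommGroup

noncomputable instance (n : ℕ) : Module ℂ (V n) := (V.equiv n).module ℂ

@[simp] theorem V.coord_add {n : ℕ} (c d : V n) (i : Fin (n + 1)) :
    (c + d).coord i = c.coord i + d.coord i := rfl

@[simp] theorem V.coord_smul {n : ℕ} (a : ℂ) (c : V n) (i : Fin (n + 1)) :
    (a • c).coord i = a * c.coord i := rfl

@[simp] theorem V.coord_neg {n : ℕ} (c : V n) (i : Fin (n + 1)) :
    (-c).coord i = -c.coord i := rfl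

@[simp] theorem V.coord_sub {n : ℕ} (c d : V n) (i : Fin (n + 1)) :
    (c - d).coord i = c.coord i - d.coord i := by
  rw [sub_eq_add_neg, V.coord_add, V.coord_neg, sub_eq_add_neg]

@[simp] theorem V.coord_zero {n : ℕ} (i : Fin (n + 1)) : (0 : V n).coord i = 0 := rfl

/-- The coordinates on `V(n)`, as a linear isomorphism. -/
def V.linearEquiv (n : ℕ) : V n ≃ₗ[ℂ] (Fin (n + 1) → ℂ) where
  __ := V.equiv n
  map_add' _ _ := rfl
  map_smul' _ _ := rfl

/-- The action of `e` on `V(n)`: `e v₀ = 0` and `e vₚ = (n - p + 1) vₚ₋₁` for `p ≥ 1`. -/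
noncomputable def E (n : ℕ) : V n →ₗ[ℂ] V n where
  toFun c := ⟨fun i => if h : (i : ℕ) + 1 < n + 1 then ((n : ℂ) - i) * c.coord ⟨i + 1, h⟩ else 0⟩
  map_add' c d := by
    ext i
    simp only [V.coord_add]
    split_ifs <;> ring
  map_smul' a c := by
    ext i
    simp only [V.coord_smul, RingHom.id_apply]
    split_ifs <;> ring

/-- The action of `f` on `V(n)`: `f vₙ = 0` and `f vₚ = (p + 1) vₚ₊₁` for `p < n`. -/
noncomputable def F (n : ℕ) : V n →ₗ[ℂ] V n where
  toFun c := ⟨fun i => (i : ℂ) * c.coord ⟨i - 1, by omega⟩⟩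
  map_add' c d := by
    ext i
    simp only [V.coord_add]
    ring
  map_smul' a c := by
    ext i
    simp only [V.coord_smul, RingHom.id_apply]
    ring

/-- The action of `h` on `V(n)`: `h vₚ = (n - 2 p) vₚ`. -/
noncomputable def H (n : ℕ) : V n →ₗ[ℂ] V n where
  toFun c := ⟨fun i => ((n : ℂ) - 2 * i) * c.coord i⟩
  map_add' c d := by
    ext i
    simp only [V.coord_add]
    ring
  map_smul' a c := by
    ext i
    simp only [V.coord_smul, RingHom.id_apply]
    ring

theorem E_apply {n : ℕ} (c : V n) (i : Fin (n + 1)) :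
    (E n c).coord i =
      if h : (i : ℕ) + 1 < n + 1 then ((n : ℂ) - i) * c.coord ⟨i + 1, h⟩ else 0 := rfl

theorem F_apply {n : ℕ} (c : V n) (i : Fin (n + 1)) :
    (F n c).coord i = (i : ℂ) * c.coord ⟨i - 1, by omega⟩ := rfl

theorem H_apply {n : ℕ} (c : V n) (i : Fin (n + 1)) :
    (H n c).coord i = ((n : ℂ) - 2 * i) * c.coord i := rfl

theorem E_F {n : ℕ} (c : V n) : E n (F n c) = F n (E n c) + H n c := by
  refine V.ext (funext ?_)
  rintro ⟨i, hi⟩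
  rcases i with _ | i
  · simp only [V.coord_add, E_apply, F_apply, H_apply]
    split_ifs with h
    · simp
    · obtain rfl : n = 0 := by omega
      simp
  · simp only [V.coord_add, E_apply, F_apply, H_apply]
    simp only [Nat.add_sub_cancel, hi, dif_pos]
    split_ifs with h
    · push_cast; ring
    · obtain rfl : n = i + 1 := by omega
      push_cast; ring

theorem H_E {n : ℕ} (c : V n) : H n (E n c) = E n (H n c) + (2 : ℂ) • E n c := by
  refine V.ext (funext ?_)
  intro i
  simp only [V.coord_add, V.coord_smul, E_apply, H_apply]
  split_ifs
  · push_cast; ring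
  · simp

theorem H_F {n : ℕ} (c : V n) : H n (F n c) = F n (H n c) - (2 : ℂ) • F n c := by
  refine V.ext (funext ?_)
  rintro ⟨i, hi⟩
  rcases i with _ | i
  · simp [F_apply, H_apply]
  · simp only [V.coord_sub, V.coord_smul, F_apply, H_apply, Nat.add_sub_cancel]
    push_cast; ring

theorem L_trace (x : L) : x.1 1 1 = - x.1 0 0 := by
  have h : Matrix.trace x.1 = 0 := LinearMap.mem_ker.1 x.2
  rw [Matrix.trace_fin_two] at h
  linear_combination h

theorem L_add (x y : L) (i j : Fin 2) : (x + y).1 i j = x.1 i j + y.1 i j := rfl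

theorem L_smul (a : ℂ) (x : L) (i j : Fin 2) : (a • x).1 i j = a * x.1 i j := rfl

theorem L_lie (x y : L) (i j : Fin 2) :
    ⁅x, y⁆.1 i j = (x.1 i 0 * y.1 0 j + x.1 i 1 * y.1 1 j) -
      (y.1 i 0 * x.1 0 j + y.1 i 1 * x.1 1 j) := by
  rw [LieAlgebra.SpecialLinear.sl_bracket, Matrix.sub_apply, Matrix.mul_apply, Matrix.mul_apply,
    Fin.sum_univ_two, Fin.sum_univ_two]

/-- The Lie algebra `sl₂` acts on `V(n)`: the matrix `!![a, b; c, -a] = a h + b e + c f` acts as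
`a H + b E + c F`. -/
noncomputable instance (n : ℕ) : LieRingModule L (V n) where
  bracket x c := x.1 0 0 • H n c + x.1 0 1 • E n c + x.1 1 0 • F n c
  add_lie x y c := by
    simp only [L_add, add_smul]
    abel
  lie_add x c d := by
    simp only [map_add, smul_add]
    abel
  leibniz_lie x y c := by
    have hx := L_trace x
    have hy := L_trace y
    simp only [L_lie, map_add, map_smul, hx, hy, E_F, H_E, H_F]
    module

theorem lie_apply {n : ℕ} (x : L) (c : V n) :
    ⁅x, c⁆ = x.1 0 0 • H n c + x.1 0 1 • E n c + x.1 1 0 • F n c := rfl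

noncomputable instance (n : ℕ) : LieModule ℂ L (V n) where
  smul_lie a x c := by
    simp only [lie_apply, L_smul]
    module
  lie_smul a x c := by
    simp only [lie_apply, map_smul]
    module

/-- `V(n)` has dimension `n + 1`. -/
theorem V.finrank_eq (n : ℕ) : Module.finrank ℂ (V n) = n + 1 :=
  (V.linearEquiv n).finrank_eq.trans (Module.finrank_fin_fun ℂ)

/-- `V(n)` is simple; so it is the simple `sl₂`-module of dimension `n + 1`. -/
instance V.isIrreducible (n : ℕ) : LieModule.IsIrreducible ℂ L (V n) := by
  have hE : ∀ (N : LieSubmodule ℂ L (V n)) (c : V n), c ∈ N → E n c ∈ N := by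
    intro N c hc
    have := N.lie_mem (x := LieAlgebra.SpecialLinear.single (0 : Fin 2) 1 (by decide) (1 : ℂ)) hc
    simpa [lie_apply] using this
  have hF : ∀ (N : LieSubmodule ℂ L (V n)) (c : V n), c ∈ N → F n c ∈ N := by
    intro N c hc
    have := N.lie_mem (x := LieAlgebra.SpecialLinear.single (1 : Fin 2) 0 (by decide) (1 : ℂ)) hc
    simpa [lie_apply] using this
  let b : Fin (n + 1) → V n := fun i => ⟨Pi.single i 1⟩
  have hb : ∀ i j, (b i).coord j = if j = i then 1 else 0 := fun i j => Pi.single_apply i (1 : ℂ) j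
  have : Nontrivial (V n) := (V.equiv n).nontrivial
  refine LieModule.IsIrreducible.mk fun N hN => ?_
  obtain ⟨v, hvN, hv0⟩ : ∃ v ∈ N, v ≠ 0 := by
    by_contra! h
    exact hN (N.eq_bot_iff.2 h)
  have key : ∀ p : ℕ, ∀ c : V n, c ∈ N → c ≠ 0 → (∀ i : Fin (n + 1), p < i → c.coord i = 0) →
      b 0 ∈ N := by
    intro p
    induction p with
    | zero =>
      intro c hc hc0 hz
      have h0 : c = c.coord 0 • b 0 := by
        refine V.ext (funext ?_); intro i
        rw [V.coord_smul, hb]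
        split_ifs with h
        · rw [h, mul_one]
        · rw [hz i (Nat.pos_of_ne_zero fun h' => h (Fin.ext h')), mul_zero]
      have hne : c.coord 0 ≠ 0 := by
        intro h; rw [h, zero_smul] at h0; exact hc0 h0
      have := N.smul_mem (c.coord 0)⁻¹ hc
      rw [h0] at this
      simpa [smul_smul, hne, hb] using this
    | succ p ih =>
      intro c hc hc0 hz
      by_cases hp : ∃ h : p + 1 < n + 1, c.coord ⟨p + 1, h⟩ ≠ 0
      · obtain ⟨h, hne⟩ := hp
        refine ih (E n c) (hE N c hc) ?_ ?_
        · intro h0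
          have := congrArg (fun d : V n => d.coord ⟨p, by omega⟩) h0
          rw [E_apply, dif_pos h, V.coord_zero] at this
          have hnp : (n : ℂ) - p ≠ 0 := by
            rw [sub_ne_zero]; exact_mod_cast (by omega : n ≠ p)
          exact (mul_ne_zero hnp hne) this
        · intro i hi
          rw [E_apply]
          split_ifs with h'
          · rw [hz ⟨i + 1, h'⟩ (by simpa using hi), mul_zero]
          · rfl
      · push Not at hp
        refine ih c hc hc0 fun i hi => ?_
        by_cases h : (i : ℕ) = p + 1
        · have := hp (h ▸ i.2)
          rwa [show i = ⟨p + 1, h ▸ i.2⟩ from Fin.ext h]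
        · exact hz i (by omega)
  have h0 : b 0 ∈ N := key n v hvN hv0 fun i hi => absurd i.2 (by omega)
  have hall : ∀ (p : ℕ) (h : p < n + 1), b ⟨p, h⟩ ∈ N := by
    intro p
    induction p with
    | zero => intro h; exact h0
    | succ p ih =>
      intro h
      have h1 := N.smul_mem ((p : ℂ) + 1)⁻¹ (hF N _ (ih (by omega)))
      have hne : (p : ℂ) + 1 ≠ 0 := by exact_mod_cast Nat.succ_ne_zero p
      refine (congrArg (· ∈ N) ?_).mpr h1
      refine V.ext (funext ?_)
      rintro ⟨i, hi⟩
      rw [V.coord_smul, F_apply, hb, hb]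
      simp only [Fin.mk.injEq]
      rcases i with _ | i
      · simp
      · by_cases hip : i = p
        · subst hip; simp [hne]
        · simp [hip]
  rw [eq_top_iff]
  intro c _
  have hc : c = ∑ i, c.coord i • b i := by
    apply (V.linearEquiv n).injective
    rw [map_sum]
    exact pi_eq_sum_univ' c.coord
  rw [hc]
  exact N.sum_mem fun i _ => N.smul_mem _ (hall i.1 i.2)

/-- A representation of `sl₂`: a complex vector space with a Lie module structure over `sl₂`. -/
structure Rep where
  carrier : Type
  [addCommGroup : AddCommGroup carrier]
  [module : Module ℂ carrier]
  [lieRingModule : LieRingModule L carrier]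
  [lieModule : LieModule ℂ L carrier]

attribute [instance] Rep.addCommGroup Rep.module Rep.lieRingModule Rep.lieModule

/-- The tensor powers of `V(1)`: `V(1)^{⊗ 0} = V(0)` and `V(1)^{⊗ (N + 1)} = V(1)^{⊗ N} ⊗ V(1)`,
where `x ∈ sl₂` acts on a tensor product by `x (u ⊗ v) = x u ⊗ v + u ⊗ x v`. -/
noncomputable def tensorPower : ℕ → Rep
  | 0 => { carrier := V 0 }
  | N + 1 => { carrier := (tensorPower N).carrier ⊗[ℂ] V 1 }

/-- `IsMultiplicity t` says that `t k N` is the multiplicity of `V(k)` in `V(1)^{⊗ N}`: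
for every `N`, `V(1)^{⊗ N} ≅ ⨁ₖ V(k)^{⊕ t(k, N)}` as `sl₂`-modules. -/
def IsMultiplicity (t : ℕ → ℕ → ℕ) : Prop :=
  ∀ N : ℕ, Nonempty
    ((tensorPower N).carrier ≃ₗ⁅ℂ, L⁆ ⨁ p : (Σ k : ℕ, Fin (t k N)), V p.1)

end SlTwo

/-! The argument reduces multiplicities to walks on the half-line ℕ. Clebsch–Gordan gives `V(n) ⊗
V(1) ≅ V(n-1) ⊕ V(n+1)`, with only `V(1)` when `n = 0`; here it is proved by explicit equivariant
maps and a dimension count (`clebschGordan_bijective`). Tensoring with `V(1)` thus moves each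
constituent to a neighbouring weight, so the number `ballot k N` of walks from 0 to `k` is a
multiplicity family (`isMultiplicity_ballot`). It is the only one, because a multiplicity is the
dimension of a space of highest weight vectors (`IsMultiplicity.eq_finrank`).

The identity then counts walks: cut a walk from 0 to `k` at its last step from `k' - 1` up to `k'`.
Before it lies any walk from 0 to `k' - 1`; after it, a walk staying at or above `k'`, which shifts
to a half-line walk from 0 to `k - k'`. The proof of `ballot_convolution` replaces this bijection by
induction on the length. -/

namespace SlTwo

/-! ### Coordinates with zero outside the range -/

/-- The coordinates of an element of `V(n)`, extended by zero to all natural numbers. -/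
noncomputable def V.ext0 {n : ℕ} (c : V n) (p : ℕ) : ℂ :=
  if h : p < n + 1 then c.coord ⟨p, h⟩ else 0

theorem V.coord_eq_ext0 {n : ℕ} (c : V n) (i : Fin (n + 1)) : c.coord i = c.ext0 i := by
  simp [V.ext0, Nat.le_of_lt_succ i.2]

theorem V.ext0_mk {n : ℕ} (g : ℕ → ℂ) {p : ℕ} (hp : p ≤ n) :
    V.ext0 (⟨fun i => g i⟩ : V n) p = g p := by
  simp [V.ext0, Nat.lt_succ_of_le hp]

theorem V.ext0_of_lt {n : ℕ} (c : V n) {p : ℕ} (hp : n < p) : c.ext0 p = 0 := by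
  simp [V.ext0, show ¬ p < n + 1 by omega]

theorem V.ext_ext0 {n : ℕ} {c d : V n} (h : ∀ p ≤ n, c.ext0 p = d.ext0 p) : c = d := by
  refine V.ext (funext fun i => ?_)
  rw [coord_eq_ext0, coord_eq_ext0, h i (by omega)]

theorem V.ext0_single {n : ℕ} (i : Fin (n + 1)) (a : ℂ) (p : ℕ) :
    (⟨Pi.single i a⟩ : V n).ext0 p = if p = i then a else 0 := by
  unfold V.ext0
  split_ifs with h h' h'
  · simp [h']
  · exact Pi.single_eq_of_ne (fun h => h' (congrArg Fin.val h)) _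
  · omega
  · rfl

@[simp] theorem V.ext0_zero {n : ℕ} (p : ℕ) : (0 : V n).ext0 p = 0 := by
  simp [V.ext0]

@[simp] theorem V.ext0_add {n : ℕ} (c d : V n) (p : ℕ) :
    (c + d).ext0 p = c.ext0 p + d.ext0 p := by
  unfold V.ext0; split_ifs <;> simp

@[simp] theorem V.ext0_smul {n : ℕ} (a : ℂ) (c : V n) (p : ℕ) :
    (a • c).ext0 p = a * c.ext0 p := by
  unfold V.ext0; split_ifs <;> simp

@[simp] theorem ext0_H {n : ℕ} (c : V n) (p : ℕ) :
    (H n c).ext0 p = ((n : ℂ) - 2 * p) * c.ext0 p := by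
  unfold V.ext0; split_ifs <;> simp [H_apply]

@[simp] theorem ext0_E {n : ℕ} (c : V n) (p : ℕ) :
    (E n c).ext0 p = ((n : ℂ) - p) * c.ext0 (p + 1) := by
  unfold V.ext0
  by_cases h : p + 1 < n + 1
  · simp [E_apply, h, show p < n + 1 by omega]
  · simp [E_apply, h]

@[simp] theorem ext0_F_zero {n : ℕ} (c : V n) : (F n c).ext0 0 = 0 := by
  simp [V.ext0, F_apply]

theorem ext0_F_succ {n : ℕ} (c : V n) {p : ℕ} (hp : p < n) :
    (F n c).ext0 (p + 1) = ((p : ℂ) + 1) * c.ext0 p := by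
  simp [V.ext0, F_apply, hp, show p < n + 1 by omega]

/-! ### Equivariant multiplication and contraction of binary forms -/

/-- The multiplication map `V(n) × V(1) → V(n + 1)` of binary forms, scaled by `n + 1`. -/
noncomputable def mulBilin (n : ℕ) : V n →ₗ[ℂ] V 1 →ₗ[ℂ] V (n + 1) :=
  -- With `v_p` read as the form `binom(n, p) x^(n-p) y^p`, these weights are `n + 1` times
  -- `binom(n, p) / binom(n+1, p)` and `binom(n, p-1) / binom(n+1, p)`.
  LinearMap.mk₂ ℂ (fun c u => ⟨fun i => ((n : ℂ) + 1 - (i : ℕ)) * c.ext0 i * u.ext0 0 +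
      (i : ℕ) * c.ext0 (i - 1) * u.ext0 1⟩)
    (fun c d u => by ext i; simp; ring) (fun a c u => by ext i; simp; ring)
    (fun c u v => by ext i; simp; ring) (fun a c u => by ext i; simp; ring)

theorem ext0_mulBilin {n : ℕ} (c : V n) (u : V 1) {p : ℕ} (hp : p ≤ n + 1) :
    (mulBilin n c u).ext0 p = ((n : ℂ) + 1 - p) * c.ext0 p * u.ext0 0 +
      p * c.ext0 (p - 1) * u.ext0 1 :=
  V.ext0_mk (fun p => ((n : ℂ) + 1 - p) * c.ext0 p * u.ext0 0 + p * c.ext0 (p - 1) * u.ext0 1) hp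

/-- The contraction `V(n + 1) × V(1) → V(n)` of binary forms. -/
noncomputable def contrBilin (n : ℕ) : V (n + 1) →ₗ[ℂ] V 1 →ₗ[ℂ] V n :=
  -- On forms this is the operator `(u₀ ∂_y - u₁ ∂_x) / (n + 1)`.
  LinearMap.mk₂ ℂ (fun c u => ⟨fun i => c.ext0 (i + 1) * u.ext0 0 - c.ext0 i * u.ext0 1⟩)
    (fun c d u => by ext i; simp; ring) (fun a c u => by ext i; simp; ring)
    (fun c u v => by ext i; simp; ring) (fun a c u => by ext i; simp; ring)

theorem ext0_contrBilin {n : ℕ} (c : V (n + 1)) (u : V 1) {p : ℕ} (hp : p ≤ n) :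
    (contrBilin n c u).ext0 p = c.ext0 (p + 1) * u.ext0 0 - c.ext0 p * u.ext0 1 :=
  V.ext0_mk (fun p => c.ext0 (p + 1) * u.ext0 0 - c.ext0 p * u.ext0 1) hp

theorem F_one_ext0_one (u : V 1) : (F 1 u).ext0 1 = u.ext0 0 := by
  simpa using ext0_F_succ u (p := 0) (by norm_num)

theorem V.ext0_two (u : V 1) : u.ext0 2 = 0 := u.ext0_of_lt (by norm_num)

/-- A bilinear map commuting with `E`, `F` and `H` induces a map of Lie modules. -/
noncomputable def homOfBilin {m n k : ℕ} (B : V m →ₗ[ℂ] V n →ₗ[ℂ] V k)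
    (hH : ∀ c u, H k (B c u) = B (H m c) u + B c (H n u))
    (hE : ∀ c u, E k (B c u) = B (E m c) u + B c (E n u))
    (hF : ∀ c u, F k (B c u) = B (F m c) u + B c (F n u)) :
    V m ⊗[ℂ] V n →ₗ⁅ℂ, L⁆ V k where
  __ := TensorProduct.lift B
  map_lie' {x t} := by
    simp only [AddHom.toFun_eq_coe, LinearMap.coe_toAddHom]
    induction t with
    | zero => simp
    | add s t hs ht => simp only [lie_add, map_add, hs, ht]
    | tmul c u =>
      simp only [TensorProduct.LieModule.lie_tmul_right, map_add, TensorProduct.lift.tmul,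
        lie_apply, hH, hE, hF, map_smul, LinearMap.add_apply, LinearMap.smul_apply]
      module

/-- Multiplication of binary forms as a map of `sl₂`-modules. -/
noncomputable def mulHom (n : ℕ) : V n ⊗[ℂ] V 1 →ₗ⁅ℂ, L⁆ V (n + 1) :=
  homOfBilin (mulBilin n)
    (fun c u => V.ext_ext0 fun p hp => by
      rcases p with _ | p <;>
      simp [ext0_mulBilin _ _ hp] <;> ring)
    (fun c u => V.ext_ext0 fun p hp => by
      rcases hp.lt_or_eq with h | rfl
      · rcases p with _ | p <;>
        simp [ext0_mulBilin _ _ hp, ext0_mulBilin _ _ (Nat.succ_le_of_lt h), V.ext0_two] <;> ring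
      · simp [ext0_mulBilin, V.ext0_of_lt])
    (fun c u => V.ext_ext0 fun p hp => by
      rcases p with _ | p
      · simp [ext0_mulBilin]
      · rw [ext0_F_succ _ (by omega), V.ext0_add, ext0_mulBilin _ _ hp, ext0_mulBilin _ _ hp,
          ext0_mulBilin _ _ (by omega), F_one_ext0_one, ext0_F_zero]
        -- At `p = n` the formula for `F` leaves the coordinate range and fails; the factor `n - p`
        -- makes the identity survive.
        have h1 : ((n : ℂ) - p) * (F n c).ext0 (p + 1) = (n - p) * ((p + 1) * c.ext0 p) := by
          rcases (Nat.le_of_succ_le_succ hp).lt_or_eq with h | rfl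
          · rw [ext0_F_succ _ h]
          · simp
        have h2 : (F n c).ext0 p = p * c.ext0 (p - 1) := by
          rcases p with _ | p
          · simp
          · rw [ext0_F_succ _ (by omega)]; simp
        rw [Nat.add_sub_cancel, h2]
        push_cast
        linear_combination -u.ext0 0 * h1)

/-- Contraction of binary forms as a map of `sl₂`-modules. -/
noncomputable def contrHom (n : ℕ) : V (n + 1) ⊗[ℂ] V 1 →ₗ⁅ℂ, L⁆ V n :=
  homOfBilin (contrBilin n)
    (fun c u => V.ext_ext0 fun p hp => by
      simp [ext0_contrBilin _ _ hp]; ring)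
    (fun c u => V.ext_ext0 fun p hp => by
      rcases hp.lt_or_eq with h | rfl
      · simp [ext0_contrBilin _ _ hp, ext0_contrBilin _ _ (Nat.succ_le_of_lt h), V.ext0_two]; ring
      · simp [ext0_contrBilin, V.ext0_of_lt])
    (fun c u => V.ext_ext0 fun p hp => by
      rcases p with _ | p
      · simp [ext0_contrBilin, ext0_F_succ]
      · rw [ext0_F_succ _ (by omega), V.ext0_add, ext0_contrBilin _ _ hp, ext0_contrBilin _ _ hp,
          ext0_contrBilin _ _ (by omega), F_one_ext0_one, ext0_F_zero, ext0_F_succ _ (by omega),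
          ext0_F_succ _ (by omega)]
        push_cast
        ring)

theorem ext0_mulHom {n : ℕ} (c : V n) (u : V 1) {p : ℕ} (hp : p ≤ n + 1) :
    (mulHom n (c ⊗ₜ u)).ext0 p = ((n : ℂ) + 1 - p) * c.ext0 p * u.ext0 0 +
      p * c.ext0 (p - 1) * u.ext0 1 :=
  ext0_mulBilin c u hp

theorem ext0_contrHom {n : ℕ} (c : V (n + 1)) (u : V 1) {p : ℕ} (hp : p ≤ n) :
    (contrHom n (c ⊗ₜ u)).ext0 p = c.ext0 (p + 1) * u.ext0 0 - c.ext0 p * u.ext0 1 :=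
  ext0_contrBilin c u hp

theorem exists_eq_tmul_add_tmul {n : ℕ} (t : V n ⊗[ℂ] V 1) :
    ∃ c d : V n, t = c ⊗ₜ ⟨Pi.single 0 1⟩ + d ⊗ₜ ⟨Pi.single 1 1⟩ := by
  induction t with
  | zero => exact ⟨0, 0, by simp⟩
  | tmul c u =>
    refine ⟨u.coord 0 • c, u.coord 1 • c, ?_⟩
    rw [TensorProduct.smul_tmul, TensorProduct.smul_tmul, ← TensorProduct.tmul_add]
    congr 1
    ext i
    fin_cases i <;> simp
  | add s t hs ht =>
    obtain ⟨c, d, rfl⟩ := hs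
    obtain ⟨c', d', rfl⟩ := ht
    exact ⟨c + c', d + d', by rw [TensorProduct.add_tmul, TensorProduct.add_tmul]; abel⟩

/-- The hypothesis `hc` is the vanishing of the contraction, put in coordinates so that `n = 0` is
included. It turns the product's coordinate `p ≤ n` into `(n + 1) c_p`; the top coordinate then
gives `d_n = 0`. -/
theorem eq_zero_of_mulHom_eq_zero {n : ℕ} (c d : V n)
    (hm : mulHom n (c ⊗ₜ ⟨Pi.single 0 1⟩ + d ⊗ₜ ⟨Pi.single 1 1⟩) = 0)
    (hc : ∀ p < n, c.ext0 (p + 1) = d.ext0 p) : c = 0 ∧ d = 0 := by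
  have key : ∀ p ≤ n + 1, ((n : ℂ) + 1 - p) * c.ext0 p + p * d.ext0 (p - 1) = 0 := by
    intro p hp
    have := congrArg (fun v : V (n + 1) => v.ext0 p) hm
    simpa [ext0_mulHom _ _ hp, V.ext0_single] using this
  have hn : (n : ℂ) + 1 ≠ 0 := by exact_mod_cast Nat.succ_ne_zero n
  have hc0 : ∀ p ≤ n, c.ext0 p = 0 := by
    intro p hp
    have h := key p (by omega)
    rcases p with _ | p
    · simpa [hn] using h
    · rw [Nat.add_sub_cancel, ← hc p (by omega)] at h
      refine (mul_eq_zero.1 ?_).resolve_left hn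
      linear_combination h
  refine ⟨V.ext_ext0 fun p hp => by simp [hc0 p hp], V.ext_ext0 fun p hp => ?_⟩
  rw [V.ext0_zero]
  rcases hp.lt_or_eq with h | rfl
  · rw [← hc p h, hc0 _ h]
  · have h := key (p + 1) le_rfl
    simpa [hn] using h

/-! ### Clebsch–Gordan for `V(n) ⊗ V(1)` -/

/-- The highest weights of the constituents of `V(n) ⊗ V(1)`. -/
def neighbours : ℕ → Finset ℕ
  | 0 => {1}
  | n + 1 => {n, n + 2}

/-- The map from `V(n) ⊗ V(1)` to the direct sum of its constituents. -/
noncomputable def clebschGordan : (n : ℕ) → V n ⊗[ℂ] V 1 →ₗ⁅ℂ, L⁆ ⨁ j : neighbours n, V j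
  | 0 => (DirectSum.lieModuleOf ℂ (neighbours 0) L (fun j => V j) ⟨1, by simp [neighbours]⟩).comp
      (mulHom 0)
  | n + 1 =>
    (DirectSum.lieModuleOf ℂ (neighbours (n + 1)) L (fun j => V j)
      ⟨n + 2, by simp [neighbours]⟩).comp (mulHom (n + 1)) +
    (DirectSum.lieModuleOf ℂ (neighbours (n + 1)) L (fun j => V j)
      ⟨n, by simp [neighbours]⟩).comp (contrHom n)

theorem lieModuleOf_apply {ι : Type} [DecidableEq ι] (f : ι → ℕ) (i : ι) (v : V (f i)) :
    DirectSum.lieModuleOf ℂ ι L (fun i => V (f i)) i v = DirectSum.of (fun i => V (f i)) i v := rfl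

theorem clebschGordan_injective (n : ℕ) : Function.Injective (clebschGordan n) := by
  rw [injective_iff_map_eq_zero]
  intro t ht
  obtain ⟨c, d, rfl⟩ := exists_eq_tmul_add_tmul t
  suffices h : c = 0 ∧ d = 0 by rw [h.1, h.2]; simp
  rcases n with _ | n
  · refine eq_zero_of_mulHom_eq_zero c d ?_ (by simp)
    exact DirectSum.of_injective (β := fun j : neighbours 0 => V j) _ (ht.trans (map_zero _).symm)
  · have h1 := congrArg (fun v => v ⟨n + 2, by simp [neighbours]⟩) ht
    have h2 := congrArg (fun v => v ⟨n, by simp [neighbours]⟩) ht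
    simp only [clebschGordan, LieModuleHom.add_apply, LieModuleHom.comp_apply, lieModuleOf_apply,
      DirectSum.add_apply, DirectSum.zero_apply, DirectSum.of_eq_same] at h1 h2
    rw [DirectSum.of_eq_of_ne _ _ _ (by simp [Subtype.ext_iff]), add_zero] at h1
    rw [DirectSum.of_eq_of_ne _ _ _ (by simp [Subtype.ext_iff]), zero_add] at h2
    refine eq_zero_of_mulHom_eq_zero c d h1 fun p hp => sub_eq_zero.1 ?_
    have := congrArg (fun v : V n => v.ext0 p) h2
    simpa [ext0_contrHom _ _ (Nat.le_of_lt_succ hp), V.ext0_single, sub_eq_add_neg] using this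

instance (n : ℕ) : Module.Finite ℂ (V n) := Module.Finite.equiv (V.linearEquiv n).symm

/-- Injectivity suffices since dimensions agree: `2 (n + 1) = n + (n + 2)`, which for `n = 0` is the
single summand of dimension 2. -/
theorem clebschGordan_bijective (n : ℕ) : Function.Bijective (clebschGordan n) := by
  refine ⟨clebschGordan_injective n, ?_⟩
  have hd : Module.finrank ℂ (V n ⊗[ℂ] V 1) = Module.finrank ℂ (⨁ j : neighbours n, V j) := by
    rw [Module.finrank_tensorProduct, Module.finrank_directSum]
    simp only [V.finrank_eq]
    rw [Finset.sum_coe_sort (neighbours n) (fun j => j + 1)]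
    rcases n with _ | n
    · simp [neighbours]
    · rw [neighbours, Finset.sum_pair (by omega)]; ring
  exact (LinearMap.injective_iff_surjective_of_finrank_eq_finrank
    (f := (clebschGordan n : V n ⊗[ℂ] V 1 →ₗ[ℂ] ⨁ j : neighbours n, V j)) hd).1
    (clebschGordan_injective n)

/-! ### Direct sums of the `V(n)` and tensoring with `V(1)` -/

section Decomposition

variable {M N : Type} [AddCommGroup M] [Module ℂ M] [LieRingModule L M]
  [AddCommGroup N] [Module ℂ N] [LieRingModule L N]

/-- A linear isomorphism commuting with the action, as an isomorphism of Lie modules. -/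
def lieEquivOfLinearEquiv (e : M ≃ₗ[ℂ] N) (h : ∀ (x : L) (m : M), e ⁅x, m⁆ = ⁅x, e m⁆) :
    M ≃ₗ⁅ℂ, L⁆ N where
  __ := e
  map_lie' {x m} := h x m

/-- `Decomposes M f` says that `M` is isomorphic to the direct sum of the `V (f i)`. -/
def Decomposes (M : Type) [AddCommGroup M] [Module ℂ M] [LieRingModule L M] {ι : Type}
    (f : ι → ℕ) : Prop :=
  Nonempty (M ≃ₗ⁅ℂ, L⁆ ⨁ i, V (f i))

theorem Decomposes.reindex {ι κ : Type} {f : ι → ℕ} {g : κ → ℕ} (h : Decomposes M f)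
    (e : ι ≃ κ) (hfg : ∀ i, g (e i) = f i) : Decomposes M g := by
  obtain rfl : g = fun k => f (e.symm k) := funext fun k => by rw [← hfg, e.apply_symm_apply]
  obtain ⟨φ⟩ := h
  refine ⟨φ.trans (lieEquivOfLinearEquiv
    (DirectSum.lequivCongrLeft ℂ (M := fun i => V (f i)) e) fun x m => ?_)⟩
  refine DFinsupp.ext fun k => ?_
  rw [DirectSum.lequivCongrLeft_apply, DirectSum.lie_module_bracket_apply,
    DirectSum.lie_module_bracket_apply, DirectSum.lequivCongrLeft_apply]

variable [LieModule ℂ L M] [LieModule ℂ L N]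

/-- The tensor product distributes over the direct sum, Clebsch–Gordan applies to each summand, and
the double sum is flattened; each of these linear isomorphisms is equivariant. -/
theorem Decomposes.tensor {ι : Type} {f : ι → ℕ} (h : Decomposes M f) :
    Decomposes (M ⊗[ℂ] V 1) (fun x : (Σ i, neighbours (f i)) => (x.2 : ℕ)) := by
  classical
  obtain ⟨φ⟩ := h
  let e₁ : M ⊗[ℂ] V 1 ≃ₗ[ℂ] (⨁ i, V (f i)) ⊗[ℂ] V 1 :=
    TensorProduct.congr φ.toLinearEquiv (LinearEquiv.refl ℂ (V 1))
  let e₂ : (⨁ i, V (f i)) ⊗[ℂ] V 1 ≃ₗ[ℂ] ⨁ i, (V (f i) ⊗[ℂ] V 1) :=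
    TensorProduct.directSumLeft ℂ ℂ (fun i => V (f i)) (V 1)
  let e₃ : (⨁ i, (V (f i) ⊗[ℂ] V 1)) ≃ₗ[ℂ] ⨁ i, ⨁ j : neighbours (f i), V j :=
    DFinsupp.mapRange.linearEquiv fun i =>
      LinearEquiv.ofBijective (clebschGordan (f i) : _ →ₗ[ℂ] _) (clebschGordan_bijective (f i))
  let e₄ : (⨁ i, ⨁ j : neighbours (f i), V j) ≃ₗ[ℂ] ⨁ x : (Σ i, neighbours (f i)), V x.2 :=
    (DirectSum.sigmaLcurryEquiv ℂ (δ := fun i (j : neighbours (f i)) => V j)).symm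
  have h₁ : ∀ (x : L) m, e₁ ⁅x, m⁆ = ⁅x, e₁ m⁆ := by
    intro x m
    induction m with
    | zero => simp
    | add s t hs ht => simp only [lie_add, map_add, hs, ht]
    | tmul c u =>
      have hφ : φ.toLinearEquiv ⁅x, c⁆ = ⁅x, φ.toLinearEquiv c⁆ := φ.toLieModuleHom.map_lie x c
      simp only [e₁, TensorProduct.LieModule.lie_tmul_right, map_add, TensorProduct.congr_tmul,
        LinearEquiv.refl_apply, hφ]
  have h₂ : ∀ (x : L) m, e₂ ⁅x, m⁆ = ⁅x, e₂ m⁆ := by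
    intro x m
    have hof : ∀ {A : ι → Type} [∀ i, AddCommGroup (A i)] [∀ i, Module ℂ (A i)]
        [∀ i, LieRingModule L (A i)] [∀ i, LieModule ℂ L (A i)] (i : ι) (a : A i),
        ⁅x, DirectSum.lof ℂ ι A i a⁆ = DirectSum.lof ℂ ι A i ⁅x, a⁆ :=
      fun i a => ((DirectSum.lieModuleOf ℂ ι L _ i).map_lie x a).symm
    induction m with
    | zero => simp
    | add s t hs ht => simp only [lie_add, map_add, hs, ht]
    | tmul c u =>
      induction c using DirectSum.induction_on with
      | zero => simp
      | add c d hc hd => simp only [TensorProduct.add_tmul, lie_add, map_add, hc, hd]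
      | of i c =>
        change e₂ ⁅x, DirectSum.lof ℂ ι _ i c ⊗ₜ u⁆ = ⁅x, e₂ (DirectSum.lof ℂ ι _ i c ⊗ₜ u)⁆
        simp only [TensorProduct.LieModule.lie_tmul_right, hof, map_add, e₂,
          TensorProduct.directSumLeft_tmul_lof]
  have h₃ : ∀ (x : L) m, e₃ ⁅x, m⁆ = ⁅x, e₃ m⁆ := by
    intro x m
    refine DFinsupp.ext fun i => ?_
    exact (clebschGordan (f i)).map_lie x (m i)
  have h₄ : ∀ (x : L) m, e₄ ⁅x, m⁆ = ⁅x, e₄ m⁆ := by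
    intro x m
    -- Equivariance is checked on the inverse of `e₄`, the currying map, where it holds
    -- definitionally in each coordinate.
    rw [LinearEquiv.symm_apply_eq]
    obtain ⟨m, rfl⟩ := e₄.symm.surjective m
    rw [e₄.apply_symm_apply]
    refine DFinsupp.ext fun i => DFinsupp.ext fun j => ?_
    rfl
  exact ⟨lieEquivOfLinearEquiv (e₁.trans (e₂.trans (e₃.trans e₄))) fun x m => by
    simp only [LinearEquiv.trans_apply, h₁, h₂, h₃, h₄]⟩

/-! ### Highest weight vectors count multiplicities -/

/-- The semisimple element of the standard basis of `sl₂`. -/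
noncomputable def hElt : L :=
  LieAlgebra.SpecialLinear.singleSubSingle (0 : Fin 2) 1 (1 : ℂ)

/-- The raising element of the standard basis of `sl₂`. -/
noncomputable def eElt : L :=
  LieAlgebra.SpecialLinear.single (0 : Fin 2) 1 (by decide) (1 : ℂ)

theorem hElt_lie {n : ℕ} (c : V n) : ⁅hElt, c⁆ = H n c := by
  simp [lie_apply, hElt]

theorem eElt_lie {n : ℕ} (c : V n) : ⁅eElt, c⁆ = E n c := by
  simp [lie_apply, eElt]

/-- The space of highest weight vectors of weight `k`. -/
noncomputable def highestWeightSpace (M : Type) [AddCommGroup M] [Module ℂ M] [LieRingModule L M]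
    [LieModule ℂ L M] (k : ℕ) : Submodule ℂ M where
  carrier := {m | ⁅eElt, m⁆ = 0 ∧ ⁅hElt, m⁆ = (k : ℂ) • m}
  add_mem' := by
    rintro a b ⟨h1, h2⟩ ⟨h3, h4⟩
    exact ⟨by rw [lie_add, h1, h3, add_zero], by rw [lie_add, h2, h4, smul_add]⟩
  zero_mem' := by simp
  smul_mem' := by
    rintro a m ⟨h1, h2⟩
    exact ⟨by rw [lie_smul, h1, smul_zero], by rw [lie_smul, h2, smul_comm]⟩

theorem mem_highestWeightSpace {k : ℕ} {m : M} :
    m ∈ highestWeightSpace M k ↔ ⁅eElt, m⁆ = 0 ∧ ⁅hElt, m⁆ = (k : ℂ) • m := Iff.rfl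

theorem finrank_highestWeightSpace_congr (φ : M ≃ₗ⁅ℂ, L⁆ N) (k : ℕ) :
    Module.finrank ℂ (highestWeightSpace M k) = Module.finrank ℂ (highestWeightSpace N k) := by
  have h : highestWeightSpace M k =
      (highestWeightSpace N k).comap (φ.toLinearEquiv : M →ₗ[ℂ] N) := by
    ext m
    change _ ↔ ⁅eElt, φ m⁆ = 0 ∧ ⁅hElt, φ m⁆ = (k : ℂ) • φ m
    have hφ : ∀ x : L, ⁅x, φ m⁆ = φ.toLinearEquiv ⁅x, m⁆ := fun x =>
      (φ.toLieModuleHom.map_lie x m).symm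
    have hs : (k : ℂ) • φ m = φ.toLinearEquiv ((k : ℂ) • m) :=
      (map_smul φ.toLinearEquiv (k : ℂ) m).symm
    rw [hφ, hφ, hs, φ.toLinearEquiv.injective.eq_iff, LinearEquiv.map_eq_zero_iff,
      mem_highestWeightSpace]
  rw [h]
  exact (φ.toLinearEquiv.ofSubmodule' _).finrank_eq

/-- The coefficient `n - p` in `E` is nonzero for `p < n`, so only multiples of `v₀` are killed, and
these have weight `n`. Hence `V(n)` contributes a line when `n = k` and nothing otherwise. -/
theorem mem_highestWeightSpace_V {n k : ℕ} {c : V n} :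
    c ∈ highestWeightSpace (V n) k ↔
      (∀ p, c.ext0 (p + 1) = 0) ∧ (n ≠ k → c.ext0 0 = 0) := by
  rw [mem_highestWeightSpace, eElt_lie, hElt_lie]
  constructor
  · rintro ⟨h1, h2⟩
    refine ⟨fun p => ?_, fun hk => ?_⟩
    · by_cases hp : p < n
      · have := congrArg (fun v : V n => v.ext0 p) h1
        simp only [ext0_E, V.ext0_zero, mul_eq_zero, sub_eq_zero, Nat.cast_inj] at this
        exact this.resolve_left (by omega)
      · exact c.ext0_of_lt (by omega)
    · have := congrArg (fun v : V n => v.ext0 0) h2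
      simp only [ext0_H, V.ext0_smul, Nat.cast_zero, mul_zero, sub_zero] at this
      rw [← sub_eq_zero, ← sub_mul, mul_eq_zero, sub_eq_zero, Nat.cast_inj] at this
      exact this.resolve_left hk
  · rintro ⟨h1, h2⟩
    refine ⟨V.ext_ext0 fun p _ => by simp [h1], V.ext_ext0 fun p _ => ?_⟩
    rcases p with _ | p
    · by_cases hk : n = k
      · simp [hk]
      · simp [h2 hk]
    · simp [h1]

theorem mem_highestWeightSpace_directSum {ι : Type} {f : ι → ℕ} {k : ℕ} {m : ⨁ i, V (f i)} :
    m ∈ highestWeightSpace (⨁ i, V (f i)) k ↔ ∀ i, m i ∈ highestWeightSpace (V (f i)) k := by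
  constructor
  · rintro ⟨h1, h2⟩ i
    exact ⟨by rw [← DirectSum.lie_module_bracket_apply, h1]; rfl,
      by rw [← DirectSum.lie_module_bracket_apply, h2]; rfl⟩
  · intro h
    exact ⟨DFinsupp.ext fun i => (h i).1, DFinsupp.ext fun i => (h i).2⟩

/-- The number of summands `V(k)` of a direct sum is the dimension of its space of highest weight
vectors of weight `k`. -/
theorem finrank_highestWeightSpace_directSum (t : ℕ → ℕ) (k : ℕ) :
    Module.finrank ℂ (highestWeightSpace (⨁ p : (Σ k : ℕ, Fin (t k)), V p.1) k) = t k := by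
  classical
  -- `T` reads off the `v₀`-coordinate in each copy of `V(k)`; it will be shown bijective.
  let T : highestWeightSpace (⨁ p : (Σ k : ℕ, Fin (t k)), V p.1) k →ₗ[ℂ] (Fin (t k) → ℂ) :=
    { toFun := fun m j => (m.1 ⟨k, j⟩).ext0 0
      map_add' := fun a b => funext fun j => V.ext0_add _ _ _
      map_smul' := fun a b => funext fun j => V.ext0_smul _ _ _ }
  have hinj : Function.Injective T := by
    rw [injective_iff_map_eq_zero]
    rintro ⟨m, hm⟩ h0
    rw [mem_highestWeightSpace_directSum] at hm
    refine Subtype.ext (DFinsupp.ext ?_)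
    rintro ⟨l, j⟩
    obtain ⟨h1, h2⟩ := mem_highestWeightSpace_V.1 (hm ⟨l, j⟩)
    refine V.ext_ext0 fun p _ => ?_
    change V.ext0 (m ⟨l, j⟩) p = V.ext0 0 p
    rw [V.ext0_zero]
    rcases p with _ | p
    · by_cases hl : l = k
      · subst hl
        exact congrFun h0 j
      · exact h2 hl
    · exact h1 p
  have hsurj : Function.Surjective T := by
    intro g
    let w : ⨁ p : (Σ k : ℕ, Fin (t k)), V p.1 :=
      ∑ j, DirectSum.of (fun p : (Σ k : ℕ, Fin (t k)) => V p.1) ⟨k, j⟩ ⟨Pi.single 0 (g j)⟩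
    have hw : w ∈ highestWeightSpace _ k := by
      refine Submodule.sum_mem _ fun j _ => ?_
      rw [mem_highestWeightSpace_directSum]
      intro i
      by_cases hi : i = ⟨k, j⟩
      · subst hi
        rw [DirectSum.of_eq_same, mem_highestWeightSpace_V]
        refine ⟨fun p => ?_, fun h => absurd rfl h⟩
        simp [V.ext0_single]
      · rw [DirectSum.of_eq_of_ne _ _ _ hi]
        exact zero_mem _
    refine ⟨⟨w, hw⟩, funext fun j => ?_⟩
    have hwj : w ⟨k, j⟩ = ⟨Pi.single 0 (g j)⟩ := by
      rw [DFinsupp.finsetSum_apply, Finset.sum_eq_single j, DirectSum.of_eq_same]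
      · intro j' _ hj
        exact DirectSum.of_eq_of_ne _ _ _ (by simpa using hj.symm)
      · simp
    change V.ext0 (w ⟨k, j⟩) 0 = g j
    rw [hwj, V.ext0_single]
    rfl
  rw [(LinearEquiv.ofBijective T ⟨hinj, hsurj⟩).finrank_eq, Module.finrank_fin_fun]

end Decomposition

/-- The right-hand side does not involve `t`, which gives uniqueness. -/
theorem IsMultiplicity.eq_finrank {t : ℕ → ℕ → ℕ} (ht : IsMultiplicity t) (k N : ℕ) :
    t k N = Module.finrank ℂ (highestWeightSpace (tensorPower N).carrier k) := by
  obtain ⟨φ⟩ := ht N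
  rw [finrank_highestWeightSpace_congr φ, finrank_highestWeightSpace_directSum (fun k => t k N)]

theorem IsMultiplicity.unique {s t : ℕ → ℕ → ℕ} (hs : IsMultiplicity s) (ht : IsMultiplicity t) :
    s = t :=
  funext fun k => funext fun N => (hs.eq_finrank k N).trans (ht.eq_finrank k N).symm

/-! ### Walks on the half-line, existence and convolution -/

/-- The number of walks of length `N` from `0` to `k` on the half-line `ℕ`. -/
def ballot (k : ℕ) : ℕ → ℕ
  | 0 => if k = 0 then 1 else 0
  | N + 1 => ∑ l ∈ neighbours k, ballot l N

theorem mem_neighbours_comm {k l : ℕ} : k ∈ neighbours l ↔ l ∈ neighbours k := by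
  rcases k with _ | k <;> rcases l with _ | l <;> simp [neighbours] <;> omega

/-- Choosing a neighbour equal to `k` of an index amounts to choosing an index over a neighbour
of `k`. -/
def sigmaFibreEquiv (d : ℕ → ℕ) (k : ℕ) :
    {x : (Σ p : (Σ k : ℕ, Fin (d k)), neighbours p.1) // (x.2 : ℕ) = k} ≃
      Σ l : neighbours k, Fin (d l) where
  toFun x := ⟨⟨x.1.1.1, mem_neighbours_comm.1 (Eq.subst (motive := (· ∈ neighbours x.1.1.1)) x.2 x.1.2.2)⟩, x.1.1.2⟩
  invFun y := ⟨⟨⟨y.1, y.2⟩, ⟨k, mem_neighbours_comm.1 y.1.2⟩⟩, rfl⟩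
  left_inv := by
    rintro ⟨⟨p, m, hm⟩, rfl⟩
    rfl
  right_inv _ := rfl

/-- This matches the index set produced by `Decomposes.tensor` with the recursion defining `ballot`,
weight by weight. -/
theorem nonempty_sigmaFibreEquiv (d : ℕ → ℕ) (k : ℕ) :
    Nonempty ({x : (Σ p : (Σ k : ℕ, Fin (d k)), neighbours p.1) // (x.2 : ℕ) = k} ≃
      {y : (Σ k : ℕ, Fin (∑ l ∈ neighbours k, d l)) // y.1 = k}) := by
  refine ⟨(sigmaFibreEquiv d k).trans ((Fintype.equivFinOfCardEq ?_).trans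
    (Equiv.sigmaSubtype (β := fun k => Fin (∑ l ∈ neighbours k, d l)) k).symm)⟩
  rw [Fintype.card_sigma]
  simp only [Fintype.card_fin]
  exact Finset.sum_coe_sort (neighbours k) d

/-- Two families with equipotent fibres agree up to reindexing. -/
theorem exists_equiv_of_fibre_equiv {ι κ α : Type} (f : ι → α) (g : κ → α)
    (h : ∀ k, Nonempty ({i // f i = k} ≃ {j // g j = k})) :
    ∃ e : ι ≃ κ, ∀ i, g (e i) = f i :=
  ⟨(Equiv.sigmaFiberEquiv f).symm.trans
    ((Equiv.sigmaCongrRight fun k => (h k).some).trans (Equiv.sigmaFiberEquiv g)),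
    fun i => ((h (f i)).some ⟨i, rfl⟩).2⟩

theorem isMultiplicity_ballot : IsMultiplicity ballot := by
  intro N
  change Decomposes (tensorPower N).carrier (fun p : (Σ k : ℕ, Fin (ballot k N)) => p.1)
  induction N with
  | zero =>
    have h : Decomposes (V 0) (fun _ : Unit => 0) :=
      ⟨lieEquivOfLinearEquiv (DirectSum.lid ℂ (V 0) Unit).symm
        (DirectSum.lieModuleOf ℂ Unit L (fun _ => V 0) ()).map_lie⟩
    refine h.reindex (κ := Σ k : ℕ, Fin (ballot k 0))
      ⟨fun _ => ⟨0, ⟨0, by simp [ballot]⟩⟩, fun _ => (), fun _ => rfl, ?_⟩ fun _ => rfl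
    rintro ⟨k, i⟩
    have hk : k = 0 := by
      by_contra hk
      have := i.2
      simp [ballot, hk] at this
    subst hk
    have := i.2
    simp only [ballot, if_true] at this
    exact congrArg (Sigma.mk 0) (Fin.ext (by simp; omega))
  | succ N ih =>
    obtain ⟨e, he⟩ := exists_equiv_of_fibre_equiv _ _ (nonempty_sigmaFibreEquiv fun k => ballot k N)
    exact ih.tensor.reindex e he

open Finset in
/-- The first passage decomposition of walks on the half-line. -/
theorem ballot_convolution (M a b : ℕ) :
    ballot (a + b + 1) (M + 1) = ∑ p ∈ antidiagonal M, ballot a p.1 * ballot b p.2 := by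
  have hs : ∀ k N, ballot (k + 1) (N + 1) = ballot k N + ballot (k + 2) N := fun k N => by
    rw [ballot, neighbours, sum_pair (by omega)]
  have h0 : ∀ N, ballot 0 (N + 1) = ballot 1 N := fun N => by simp [ballot, neighbours]
  induction M generalizing a b with
  | zero =>
    rw [hs]
    simp [ballot]
    rcases a with _ | a <;> simp
  | succ M ih =>
    -- Splitting off `p.1 = 0` leaves first factors of positive length, to which the recursion in
    -- `a` applies.
    rw [hs, Nat.sum_antidiagonal_succ]
    rcases a with _ | a
    -- At the wall the only neighbour is 1, so the induction hypothesis is used at `a = 1`; the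
    -- split-off term supplies `ballot b (M + 1)`.
    · simp only [h0, ← ih]
      simp [ballot, show 1 + b + 1 = b + 2 by omega]
    -- Here the split-off term is zero, and the two neighbours of `a + 1` give two instances of the
    -- induction hypothesis.
    · simp only [hs, add_mul, sum_add_distrib, ← ih]
      rw [show a + 1 + b = a + b + 1 by omega, show a + 2 + b = a + b + 2 by omega, hs]
      simp [ballot.eq_1 (a + 1)]

end SlTwo

theorem corollary2p5 :
    (∃! t : ℕ → ℕ → ℕ, SlTwo.IsMultiplicity t) ∧
    ∀ t : ℕ → ℕ → ℕ, SlTwo.IsMultiplicity t →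
      ∀ k N k' : ℕ, 1 ≤ k → 1 ≤ N → 1 ≤ k' → k' ≤ k →
        t k N = ∑ i ∈ Finset.range N, t (k' - 1) i * t (k - k') (N - i - 1) := by
  refine ⟨⟨SlTwo.ballot, SlTwo.isMultiplicity_ballot,
    fun t ht => ht.unique SlTwo.isMultiplicity_ballot⟩, fun t ht k N k' _ hN hk' hk => ?_⟩
  obtain rfl := ht.unique SlTwo.isMultiplicity_ballot
  -- The cut step from `k' - 1` to `k'` uses one unit of length, leaving `M = N - 1` for the two
  -- pieces.
  obtain ⟨M, rfl⟩ := Nat.exists_eq_add_of_le' hN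
  have h := SlTwo.ballot_convolution M (k' - 1) (k - k')
  rw [show k' - 1 + (k - k') + 1 = k by omega,
    Finset.Nat.sum_antidiagonal_eq_sum_range_succ_mk] at h
  rw [h]
  refine Finset.sum_congr rfl fun i _ => ?_
  rw [show M + 1 - i - 1 = M - i by omega]
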